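/- Consider the $\mathsf{CONGEST}$ model: the nodes of a network $G=(V,E)$ on $n$ nodes carry distinct identifiers of $O(\log n)$ bits (i.e. natural numbers less than $n^{a}$ for a constant $a$); initially each node knows only its own identifier, the identifiers of its neighbours and a private string of independent fair random bits; in each synchronous round every node performs unrestricted local computation and sends a message of $O(\log n)$ bits to each of its neighbours. An algorithm decides a graph property on a run if every node halts, all nodes output "yes" if $G$ has the property, and at least one node outputs "no" otherwise. Say that $G$ is $H$-free if there is no injective map $\varphi:V(H)\to V(G)$ with $uv\in E(H)\Rightarrow \varphi(u)\varphi(v)\in E(G)$, and induced $H$-free if there is no injective map $\varphi$ with $uv\in E(H)\Leftrightarrow \varphi(u)\varphi(v)\in E(G)$. **Theorem.** Let $H$ be a fixed finite graph. On graphs $G$ of diameter $2$, $H$-freeness and induced $H$-freeness can each be decided in the $\mathsf{CONGEST}$ model in $O(n\log^2 n)$ rounds with high probability. That is, for each of the two properties and for all constants $a,c$ there are a randomized algorithm and constants $B,C$ (depending only on $H,a,c$) such that on every $n$-node graph $G$ of diameter $2$ with distinct identifiers less than $n^a$, all messages have at most $B\log n$ bits, and with probability at least $1-n^{-c}$ all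 nodes halt within $C\,n\log^2 n$ rounds with outputs that correctly decide the property. -/

import Mathlib

open MeasureTheory

universe u

namespace Congest

/-- A synchronous randomized message-passing algorithm, run by every node of the network.
The same algorithm is run on all networks: it is not told the number of nodes.
Local computation is unrestricted. -/
structure Algorithm where
  /-- local states of a node -/
  State : Type
  /-- initial state, from the node's identifier, the set of identifiers of its neighbours and
  its private tape of random bits -/
  init : ℕ → Finset ℕ → (ℕ → Bool) → State
  /-- the message to be sent to the neighbour with the given identifier -/
  send : State → ℕ → List Bool
  /-- the new state, given for each identifier the message received from that neighbour -/
  receive : State → (ℕ → List Bool) → State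
  /-- `none` while the node is running; `some b` once it has halted with output `b` -/
  output : State → Option Bool

variable {V : Type u} [Fintype V]

open Classical in
/-- The identifiers of the neighbours of `v`. -/
noncomputable def neighborIds (G : SimpleGraph V) (ident : V ↪ ℕ) (v : V) : Finset ℕ :=
  (Finset.univ.filter fun u => G.Adj v u).map ident

open Classical in
/-- What the node `v` receives when the nodes are in the states `s`: for the identifier of a
neighbour, the message of that neighbour; otherwise nothing. A halted node sends nothing. -/
noncomputable def Algorithm.inbox (A : Algorithm) (G : SimpleGraph V) (ident : V ↪ ℕ)
    (s : V → A.State) (v : V) : ℕ → List Bool :=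
  Function.extend ident
    (fun u => if G.Adj u v ∧ A.output (s u) = none then A.send (s u) (ident v) else [])
    (fun _ => [])

/-- The states of all nodes after `t` rounds, when `ω v` is the random tape of the node `v`.
A halted node keeps its state, hence its output, forever. -/
noncomputable def Algorithm.run (A : Algorithm) (G : SimpleGraph V) (ident : V ↪ ℕ)
    (ω : V → ℕ → Bool) : ℕ → V → A.State
  | 0 => fun v => A.init (ident v) (neighborIds G ident v) (ω v)
  | t + 1 => fun v =>
      if A.output (A.run G ident ω t v) = none then
        A.receive (A.run G ident ω t v) (A.inbox G ident (A.run G ident ω t) v)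
      else A.run G ident ω t v

/-- Every message ever sent, whatever the random bits, has at most `b` bits. -/
def Algorithm.HasBandwidth (A : Algorithm) (G : SimpleGraph V) (ident : V ↪ ℕ) (b : ℝ) : Prop :=
  ∀ (ω : V → ℕ → Bool) (t : ℕ) (v : V) (i : ℕ),
    ((A.inbox G ident (A.run G ident ω t) v i).length : ℝ) ≤ b

/-- With random tapes `ω`, after `T` rounds all nodes have halted and their outputs decide `p`:
if `p` holds all nodes output yes, otherwise at least one node outputs no. -/
def Algorithm.DecidesBy (A : Algorithm) (G : SimpleGraph V) (ident : V ↪ ℕ) (p : Prop)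
    (T : ℕ) (ω : V → ℕ → Bool) : Prop :=
  (∀ v, A.output (A.run G ident ω T v) ≠ none) ∧
  (p → ∀ v, A.output (A.run G ident ω T v) = some true) ∧
  (¬ p → ∃ v, A.output (A.run G ident ω T v) = some false)

/-- The law of the random tapes: independent fair bits. -/
noncomputable def tapeMeasure (V : Type u) [Fintype V] : Measure (V → ℕ → Bool) :=
  Measure.pi fun _ : V =>
    Measure.infinitePi fun _ : ℕ => (PMF.uniformOfFintype Bool).toMeasure

/-- In the CONGEST model, the graph property `P` can be decided on graphs of diameter 2 in
`O(n log² n)` rounds with high probability. Identifiers are distinct and less than `n ^ a`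
(that is, they have `O(log n)` bits), messages have `O(log n)` bits, and for every `c` the failure
probability can be made at most `1 / n ^ c`. -/
def DecidableOnDiameterTwo (P : ∀ V : Type u, SimpleGraph V → Prop) : Prop :=
  ∀ a c : ℕ, ∃ (A : Algorithm) (B C : ℝ),
    ∀ (V : Type u) [Fintype V] (G : SimpleGraph V) (ident : V ↪ ℕ),
      G.ediam = 2 → (∀ v, ident v < Fintype.card V ^ a) →
      A.HasBandwidth G ident (B * Real.log (Fintype.card V)) ∧
      ∃ T : ℕ, (T : ℝ) ≤ C * (Fintype.card V * Real.log (Fintype.card V) ^ 2) ∧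
        MeasurableSet {ω | A.DecidesBy G ident (P V G) T ω} ∧
        1 - 1 / (Fintype.card V : ℝ) ^ c ≤
          (tapeMeasure V).real {ω | A.DecidesBy G ident (P V G) T ω}

end Congest

namespace Congest.Gather

/-! A deterministic algorithm that lets a node of maximum degree learn the whole network, if the
diameter is at most 2. Let `Δ` be the maximum degree and call the node of degree `Δ` with the
largest identifier the leader. Every message is a single number, written in binary.
* Rounds `0, 1`: the nodes agree on `Δ`; rounds `2, 3`: they agree on the leader.
* Rounds `4 + i`, `i < Δ`: every node announces its `i`-th neighbour.
* Round `4 + Δ`: every neighbour of the leader announces its rank among these neighbours.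
* Rounds `5 + Δ + j`, `j < Δ`: a node tells the leader's neighbour of rank `i` who the `i`-th
  neighbour of its own `j`-th neighbour is. As the diameter is at most 2, the leader's neighbour of
  rank `i` now knows the `i`-th neighbour of every node.
* Rounds `5 + 2 * Δ + j`, `j < n`: it reports the `i`-th neighbour of the `j`-th node.
As all degrees are at most `Δ`, the leader has then heard of all edges. -/

/-! A deterministic algorithm with `5 + 2 * Δ + n ≤ 6 * n` rounds suffices, and it treats every
isomorphism-invariant property at once, because one node learns a copy of `G`. To avoid congestion,
the adjacency lists are cut into `Δ` columns, column `i` holding the `i`-th neighbour of each node.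
A leader of degree exactly `Δ` has one neighbour to collect each column. All columns reach their
collectors within `Δ` rounds: every node is within distance two of a collector, and a middle node
passes on to it one number per neighbour of its own (`view_heard_relay`, `view_report`). The
collectors then forward their columns in parallel in `n` rounds (`view_isEdge`). The agreement on
`Δ` and on the leader rests on the fact that a maximum spreads everywhere in two rounds
(`localMax_localMax`). -/

/-- The inverse of `Nat.bits`. -/
def ofBits (l : List Bool) : ℕ := l.foldr Nat.bit 0

@[simp] lemma ofBits_nil : ofBits [] = 0 := rfl

@[simp] lemma ofBits_bits (n : ℕ) : ofBits n.bits = n := by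
  induction n using Nat.binaryRec' with
  | zero => simp
  | bit b n h ih =>
    rw [Nat.bits_append_bit n b h]
    simpa [ofBits] using congrArg (Nat.bit b) ih

/-! ### Ranks within finite sets of identifiers. -/

/-- One more than the `i`-th smallest element of `S`, or `0` if there is none. -/
noncomputable def entry (S : Finset ℕ) (i : ℕ) : ℕ :=
  -- The shift by one frees `0` to mean "no entry", as `0` may be an identifier.
  if i < S.card then Nat.nth (· ∈ S) i + 1 else 0

/-- The number of elements of `S` less than `x`. -/
def rank (S : Finset ℕ) (x : ℕ) : ℕ := Nat.count (· ∈ S) x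

lemma nth_mem {S : Finset ℕ} {i : ℕ} (h : i < S.card) : Nat.nth (· ∈ S) i ∈ S :=
  Nat.nth_mem (p := (· ∈ S)) i fun hf => by
    convert h
    ext x; simp

lemma rank_nth {S : Finset ℕ} {i : ℕ} (h : i < S.card) : rank S (Nat.nth (· ∈ S) i) = i :=
  Nat.count_nth fun hf => by
    convert h
    ext x; simp

lemma nth_rank {S : Finset ℕ} {x : ℕ} (h : x ∈ S) : Nat.nth (· ∈ S) (rank S x) = x :=
  Nat.nth_count (p := (· ∈ S)) h

lemma rank_lt {S : Finset ℕ} {x : ℕ} (h : x ∈ S) : rank S x < S.card := by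
  have hf : (Set.ofPred (· ∈ S)).Finite := S.finite_toSet
  have := Nat.count_lt_card (p := (· ∈ S)) hf h
  refine this.trans_eq (congrArg Finset.card ?_)
  ext x; simp

lemma mem_iff_exists_entry {S : Finset ℕ} {D : ℕ} (h : S.card ≤ D) (x : ℕ) :
    x ∈ S ↔ ∃ i < D, entry S i = x + 1 := by
  constructor
  · intro hx
    exact ⟨rank S x, (rank_lt hx).trans_le h, by simp [entry, rank_lt hx, nth_rank hx]⟩
  · rintro ⟨i, -, hi⟩
    by_cases hS : i < S.card
    · simp only [entry, hS, if_true, add_left_inj] at hi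
      exact hi ▸ nth_mem hS
    · simp [entry, hS] at hi

lemma entry_le {S : Finset ℕ} {b : ℕ} (h : ∀ x ∈ S, x + 1 ≤ b) (i : ℕ) : entry S i ≤ b := by
  unfold entry
  split_ifs with hi
  · exact h _ (nth_mem hi)
  · exact Nat.zero_le _

/-! ### Local states and message rules. -/

/-- What a node knows: its identifier, the identifiers of its neighbours, the number of rounds
passed, and the number `heard t i` that it received from the node `i` in round `t`. -/
structure View where
  id : ℕ
  nbrs : Finset ℕ
  time : ℕ
  heard : ℕ → ℕ → ℕ

namespace View

variable (s : View)

/-- The maximum of `x` and the numbers received in round `t`. -/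
def maxHeard (x t : ℕ) : ℕ := max x (s.nbrs.sup (s.heard t))

/-- The maximum degree. -/
def Δ : ℕ := s.maxHeard (s.maxHeard s.nbrs.card 0) 1

/-- The bid of a node for leadership. -/
def bid : ℕ := if s.nbrs.card = s.Δ then s.id + 1 else 0

/-- The identifier of the leader. -/
def leader : ℕ := s.maxHeard (s.maxHeard s.bid 2) 3 - 1

/-- The neighbours of the neighbour `y`. -/
def nbrsOf (y : ℕ) : Finset ℕ :=
  (((Finset.range s.Δ).image fun i => s.heard (4 + i) y).erase 0).image Nat.pred

/-- The identifiers of the nodes at distance at most 2. -/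
def nodes : Finset ℕ := insert s.id (s.nbrs ∪ s.nbrs.biUnion s.nbrsOf)

/-- One more than the rank of the node among the neighbours of the leader, or `0` if it is not one
of these. -/
def index : ℕ := if s.leader ∈ s.nbrs then rank (s.nbrsOf s.leader) s.id + 1 else 0

/-- What the neighbour `u` is told about the `j`-th neighbour. -/
noncomputable def relay (u j : ℕ) : ℕ :=
  if s.heard (4 + s.Δ) u ≠ 0 ∧ j < s.nbrs.card then
    entry (s.nbrsOf (Nat.nth (· ∈ s.nbrs) j)) (s.heard (4 + s.Δ) u - 1)
  else 0

/-- For a node whose rank among the neighbours of the leader is `i`, the `i`-th neighbour of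
the node `w`. -/
noncomputable def report (w : ℕ) : ℕ :=
  if w = s.id then entry s.nbrs (s.index - 1)
  else if w ∈ s.nbrs then entry (s.nbrsOf w) (s.index - 1)
  else (s.nbrs.filter fun y => w ∈ s.nbrsOf y).sup fun y =>
    s.heard (5 + s.Δ + rank (s.nbrsOf y) w) y

/-- The number to be sent to the neighbour `u`. -/
noncomputable def message (u : ℕ) : ℕ :=
  if s.time = 0 then s.nbrs.card
  else if s.time = 1 then s.maxHeard s.nbrs.card 0
  else if s.time = 2 then s.bid
  else if s.time = 3 then s.maxHeard s.bid 2
  else if s.time < 4 + s.Δ then entry s.nbrs (s.time - 4)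
  else if s.time = 4 + s.Δ then s.index
  else if s.time < 5 + 2 * s.Δ then s.relay u (s.time - (5 + s.Δ))
  else if s.time < 5 + 2 * s.Δ + s.nodes.card then
    s.report (Nat.nth (· ∈ s.nodes) (s.time - (5 + 2 * s.Δ)))
  else 0

/-- The edges, as seen by the leader in the end. -/
def IsEdge (w x : ℕ) : Prop :=
  ∃ u ∈ s.nbrs, s.heard (5 + 2 * s.Δ + rank s.nodes w) u = x + 1

/-- The network, as seen by the leader in the end. -/
def graph : SimpleGraph (ULift.{u} {x // x ∈ s.nodes}) :=
  SimpleGraph.fromRel fun w x => s.IsEdge w.down x.down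

/-- All rounds are over. -/
def IsFinal : Prop :=
  2 ≤ s.time ∧ 4 + s.Δ ≤ s.time ∧ s.time = 5 + 2 * s.Δ + s.nodes.card

/-- The view after receiving the messages `m`. -/
def receive (m : ℕ → List Bool) : View where
  id := s.id
  nbrs := s.nbrs
  time := s.time + 1
  heard := Function.update s.heard s.time fun i => ofBits (m i)

lemma mem_nbrsOf {x y : ℕ} : x ∈ s.nbrsOf y ↔ ∃ i < s.Δ, s.heard (4 + i) y = x + 1 := by
  simp only [nbrsOf, Finset.mem_image, Finset.mem_erase, Finset.mem_range]
  constructor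
  · rintro ⟨_, ⟨h0, i, hi, rfl⟩, rfl⟩
    exact ⟨i, hi, (Nat.succ_pred h0).symm⟩
  · rintro ⟨i, hi, h⟩
    exact ⟨x + 1, ⟨by simp, i, hi, h⟩, rfl⟩

/-- All numbers known to a node are at most `b`. -/
structure IsBounded (b : ℕ) : Prop where
  id : s.id + 1 ≤ b
  nbrs : ∀ x ∈ s.nbrs, x + 1 ≤ b
  card : s.nbrs.card ≤ b
  heard : ∀ t i, s.heard t i ≤ b

variable {s}

lemma IsBounded.maxHeard {b x : ℕ} (h : s.IsBounded b) (hx : x ≤ b) (t : ℕ) :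
    s.maxHeard x t ≤ b :=
  max_le hx (Finset.sup_le fun i _ => h.heard t i)

lemma IsBounded.bid {b : ℕ} (h : s.IsBounded b) : s.bid ≤ b := by
  unfold View.bid
  split_ifs
  exacts [h.id, Nat.zero_le _]

lemma IsBounded.entry_nbrsOf {b : ℕ} (h : s.IsBounded b) (y i : ℕ) :
    entry (s.nbrsOf y) i ≤ b :=
  entry_le (fun x hx => by
    obtain ⟨i, -, hi⟩ := s.mem_nbrsOf.1 hx
    exact hi ▸ h.heard _ _) i

/-- Messages are degrees, maxima of known numbers, shifted identifiers, shifted ranks or `0`, so no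
rule exceeds the bound on what is known. -/
lemma IsBounded.message {b : ℕ} (h : s.IsBounded b) (u : ℕ) : s.message u ≤ b := by
  unfold View.message
  split_ifs
  · exact h.card
  · exact h.maxHeard h.card 0
  · exact h.bid
  · exact h.maxHeard h.bid 2
  · exact entry_le h.nbrs _
  · unfold View.index
    split_ifs
    -- At most `id` natural numbers lie below `id`, so the rank is at most `id` whatever the set is.
    · exact (Nat.succ_le_succ (Nat.count_le _)).trans h.id
    · exact Nat.zero_le _
  · unfold View.relay
    split_ifs
    · exact h.entry_nbrsOf _ _
    · exact Nat.zero_le _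
  · unfold View.report
    split_ifs
    · exact entry_le h.nbrs _
    · exact h.entry_nbrsOf _ _
    · exact Finset.sup_le fun y _ => h.heard _ _
  · exact Nat.zero_le _

lemma IsBounded.receive {b : ℕ} (h : s.IsBounded b) {m : ℕ → List Bool}
    (hm : ∀ i, ofBits (m i) ≤ b) : (s.receive m).IsBounded b where
  id := h.id
  nbrs := h.nbrs
  card := h.card
  heard t i := by
    by_cases ht : t = s.time
    · simp [View.receive, ht, hm]
    · simp [View.receive, ht, h.heard]

end View

open Classical in
/-- The algorithm that gathers the network at the leader, who then decides the property `P`. -/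
noncomputable def algorithm (P : ∀ V : Type u, SimpleGraph V → Prop) : Algorithm where
  State := View
  init i N _ := ⟨i, N, 0, fun _ _ => 0⟩
  send s u := (s.message u).bits
  receive s m := s.receive m
  output s :=
    if s.IsFinal then some (decide (s.leader = s.id → P _ s.graph.{u})) else none

/-! ### Message length. -/

section Bandwidth

variable {V : Type u} [Fintype V] {G : SimpleGraph V} {ident : V ↪ ℕ}

lemma mem_neighborIds {u v : V} : ident u ∈ neighborIds G ident v ↔ G.Adj v u := by
  simp [neighborIds]

lemma mem_neighborIds_iff {x : ℕ} {v : V} :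
    x ∈ neighborIds G ident v ↔ ∃ u, G.Adj v u ∧ ident u = x := by
  simp [neighborIds]

lemma card_neighborIds_le (v : V) : (neighborIds G ident v).card ≤ Fintype.card V := by
  rw [neighborIds, Finset.card_map]
  exact Finset.card_le_univ _

lemma inbox_le {P : ∀ V : Type u, SimpleGraph V → Prop} {b : ℕ} {s : V → View}
    (hs : ∀ v, (s v).IsBounded b) (v : V) (i : ℕ) :
    ∃ m ≤ b, (algorithm P).inbox G ident s v i = m.bits := by
  unfold Algorithm.inbox
  by_cases hi : ∃ u, ident u = i
  · obtain ⟨u, rfl⟩ := hi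
    rw [ident.injective.extend_apply]
    split_ifs
    · exact ⟨_, (hs u).message _, rfl⟩
    · exact ⟨0, Nat.zero_le _, by simp⟩
  · exact ⟨0, Nat.zero_le _, by simp [Function.extend_apply' _ _ _ hi]⟩

lemma isBounded_run (P : ∀ V : Type u, SimpleGraph V → Prop) {b : ℕ} (hcard : Fintype.card V ≤ b)
    (hident : ∀ v, ident v + 1 ≤ b) (ω : V → ℕ → Bool) (t : ℕ) (v : V) :
    View.IsBounded ((algorithm P).run G ident ω t v) b := by
  induction t generalizing v with
  | zero =>
    refine ⟨hident v, fun x hx => ?_, (card_neighborIds_le v).trans hcard, fun _ _ => Nat.zero_le _⟩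
    obtain ⟨u, -, rfl⟩ := mem_neighborIds_iff.1 hx
    exact hident u
  | succ t ih =>
    rw [Algorithm.run]
    beta_reduce
    split_ifs
    · refine (ih v).receive fun i => ?_
      obtain ⟨m, hm, h⟩ := inbox_le (P := P) (G := G) (ident := ident) ih v i
      rw [h, ofBits_bits]
      exact hm
    · exact ih v

lemma length_bits_le {n k m : ℕ} (hn : 2 ≤ n) (hm : m ≤ n ^ k) :
    (m.bits.length : ℝ) ≤ (2 * (k + 1) / Real.log 2) * Real.log n := by
  have h2 : 0 < Real.log 2 := Real.log_pos one_lt_two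
  have hlog : Real.log 2 ≤ Real.log n := Real.log_le_log two_pos (by exact_mod_cast hn)
  have h1 : m.bits.length ≤ (Nat.log 2 n + 1) * (k + 1) := by
    rw [Nat.size_eq_bits_len, Nat.size_le, pow_mul]
    calc m ≤ n ^ k := hm
      -- The extra exponent yields the strict inequality that `Nat.size_le` asks for.
      _ < n ^ (k + 1) := Nat.pow_lt_pow_right (by omega) (by omega)
      _ ≤ _ := Nat.pow_le_pow_left (Nat.lt_pow_succ_log_self one_lt_two n).le _
  have h3 : (Nat.log 2 n : ℝ) + 1 ≤ 2 * (Real.log n / Real.log 2) := by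
    have h4 := Real.natLog_le_logb n 2
    have h5 : 1 ≤ Real.log n / Real.log 2 := (one_le_div h2).2 hlog
    rw [Real.logb] at h4
    push_cast at h4
    linarith
  calc (m.bits.length : ℝ) ≤ ((Nat.log 2 n : ℝ) + 1) * (k + 1) := by exact_mod_cast h1
    _ ≤ 2 * (Real.log n / Real.log 2) * (k + 1) := by gcongr
    _ = _ := by ring

lemma hasBandwidth (P : ∀ V : Type u, SimpleGraph V → Prop) {a : ℕ} (hn : 2 ≤ Fintype.card V)
    (hident : ∀ v, ident v < Fintype.card V ^ a) :
    (algorithm P).HasBandwidth G ident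
      ((2 * ((a + 1 : ℕ) + 1) / Real.log 2) * Real.log (Fintype.card V)) := by
  intro ω t v i
  -- The exponent `a + 1` covers both the shifted identifiers and the degrees.
  have hs := isBounded_run (G := G) (ident := ident) P (b := Fintype.card V ^ (a + 1))
    (Nat.le_self_pow (by omega) _)
    (fun v => (hident v).trans_le (Nat.pow_le_pow_right (by omega) (by omega))) ω t
  obtain ⟨m, hm, h⟩ := inbox_le (P := P) (G := G) (ident := ident) hs v i
  rw [h]
  exact length_bits_le hn hm

end Bandwidth

/-! ### The run without halting. -/

section Correctness

variable {V : Type u} [Fintype V] (G : SimpleGraph V) (ident : V ↪ ℕ)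

open Classical in
/-- The views of the nodes after `t` rounds, when no node ever halts. -/
noncomputable def view : ℕ → V → View
  | 0 => fun v => ⟨ident v, neighborIds G ident v, 0, fun _ _ => 0⟩
  | t + 1 => fun v => (view t v).receive (Function.extend ident
      (fun u => if G.Adj u v then ((view t u).message (ident v)).bits else []) fun _ => [])

@[simp] lemma view_id (t : ℕ) (v : V) : (view G ident t v).id = ident v := by
  induction t with
  | zero => rfl
  | succ t ih => exact ih

@[simp] lemma view_nbrs (t : ℕ) (v : V) : (view G ident t v).nbrs = neighborIds G ident v := by
  induction t with
  | zero => rfl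
  | succ t ih => exact ih

@[simp] lemma view_time (t : ℕ) (v : V) : (view G ident t v).time = t := by
  induction t with
  | zero => rfl
  | succ t ih => exact congrArg Nat.succ ih

/-- Row `r` of the table is written in round `r` and never changed, so what is known later reduces
to what was sent. -/
lemma view_heard {r t : ℕ} (hr : r < t) {u v : V} (h : G.Adj v u) :
    (view G ident t v).heard r (ident u) = (view G ident r u).message (ident v) := by
  induction t with
  | zero => omega
  | succ t ih =>
    rcases eq_or_ne r t with rfl | hrt
    · simp [view, View.receive, ident.injective.extend_apply, h.symm]
    · rw [← ih (by omega)]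
      simp [view, View.receive, hrt]

/-! ### Maxima in two rounds, and the choice of the leader. -/

open Classical in
/-- The maximum of `f` over the closed neighbourhood of `v`. -/
noncomputable def localMax (f : V → ℕ) (v : V) : ℕ :=
  max (f v) ((Finset.univ.filter fun u => G.Adj v u).sup f)

lemma maxHeard_eq {t r : ℕ} {v : V} {f : V → ℕ}
    (h : ∀ u, G.Adj v u → (view G ident t v).heard r (ident u) = f u) :
    (view G ident t v).maxHeard (f v) r = localMax G f v := by
  rw [View.maxHeard, localMax, view_nbrs, neighborIds, Finset.sup_map]
  congr 1
  exact Finset.sup_congr rfl fun u hu => h u (by simpa using hu)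

/-- Any two nodes are equal, adjacent or have a common neighbour. -/
def IsWithinTwo : Prop := ∀ u v, u = v ∨ G.Adj u v ∨ ∃ w, G.Adj u w ∧ G.Adj w v

variable {G}

omit [Fintype V] in
lemma isWithinTwo_of_ediam (h : G.ediam = 2) : IsWithinTwo G := by
  intro u v
  have huv : G.edist u v ≤ 2 := h ▸ SimpleGraph.edist_le_ediam
  obtain ⟨p, hp⟩ := SimpleGraph.exists_walk_of_edist_ne_top
    (ne_top_of_le_ne_top (by simp) huv)
  rw [← hp] at huv
  have hlen : p.length ≤ 2 := by exact_mod_cast huv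
  match p, hlen with
  | .nil, _ => exact .inl rfl
  | .cons h .nil, _ => exact .inr (.inl h)
  | .cons h (.cons h' .nil), _ => exact .inr (.inr ⟨_, h, h'⟩)
  | .cons _ (.cons _ (.cons _ p)), hlen =>
    simp only [SimpleGraph.Walk.length_cons] at hlen
    omega

lemma le_localMax (f : V → ℕ) {u v : V} (h : v = u ∨ G.Adj v u) : f u ≤ localMax G f v := by
  classical
  rcases h with rfl | h
  · exact le_max_left _ _
  · exact le_max_of_le_right (Finset.le_sup (f := f) (by simpa using h))

lemma localMax_localMax (hG : IsWithinTwo G) (f : V → ℕ) (v : V) :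
    localMax G (localMax G f) v = Finset.univ.sup f := by
  classical
  have hle (v : V) : localMax G f v ≤ Finset.univ.sup f :=
    max_le (Finset.le_sup (Finset.mem_univ v)) (Finset.sup_mono (Finset.subset_univ _))
  refine le_antisymm (max_le (hle v) (Finset.sup_le fun u _ => hle u))
    (Finset.sup_le fun u _ => ?_)
  rcases hG v u with h | h | ⟨w, hw, hu⟩
  · exact (le_localMax f (.inl h)).trans (le_localMax _ (.inl rfl))
  · exact (le_localMax f (.inr h)).trans (le_localMax _ (.inl rfl))
  · exact (le_localMax f (.inr hu)).trans (le_localMax _ (.inr hw))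

variable (G)

/-- The maximum degree. -/
noncomputable def maxDeg : ℕ := Finset.univ.sup fun v => (neighborIds G ident v).card

lemma card_neighborIds_le_maxDeg (v : V) : (neighborIds G ident v).card ≤ maxDeg G ident :=
  Finset.le_sup (f := fun v => (neighborIds G ident v).card) (Finset.mem_univ v)

lemma maxDeg_le : maxDeg G ident ≤ Fintype.card V :=
  Finset.sup_le fun v _ => card_neighborIds_le v

variable {G} (hG : IsWithinTwo G)
include hG

lemma view_Δ {t : ℕ} (ht : 2 ≤ t) (v : V) : (view G ident t v).Δ = maxDeg G ident := by
  -- Needed both at the receiver's time `t` and at time `1`, when the neighbours compose their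
  -- messages.
  have h1 {r : ℕ} (hr : 1 ≤ r) (v : V) :
      (view G ident r v).maxHeard (neighborIds G ident v).card 0 =
        localMax G (fun v => (neighborIds G ident v).card) v :=
    maxHeard_eq G ident (f := fun v => (neighborIds G ident v).card) fun u hu => by
      rw [view_heard G ident (by omega) hu]
      simp [View.message]
  rw [maxDeg, ← localMax_localMax hG _ v, View.Δ, view_nbrs, h1 (by omega)]
  refine maxHeard_eq G ident fun u hu => ?_
  rw [view_heard G ident (by omega) hu, ← h1 le_rfl]
  simp [View.message]

lemma exists_leader [Nonempty V] : ∃ l : V,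
    (neighborIds G ident l).card = maxDeg G ident ∧
    ∀ t, 4 ≤ t → ∀ v, (view G ident t v).leader = ident l := by
  classical
  let f : V → ℕ := fun v =>
    if (neighborIds G ident v).card = maxDeg G ident then ident v + 1 else 0
  have hbid {t : ℕ} (ht : 2 ≤ t) (v : V) : (view G ident t v).bid = f v := by
    simp [View.bid, view_Δ ident hG ht, f]
  have h1 {r : ℕ} (hr : 3 ≤ r) (v : V) :
      (view G ident r v).maxHeard (f v) 2 = localMax G f v :=
    maxHeard_eq G ident fun u hu => by
      rw [view_heard G ident (by omega) hu]
      simp [View.message, hbid]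
  have h2 {t : ℕ} (ht : 4 ≤ t) (v : V) :
      (view G ident t v).leader = Finset.univ.sup f - 1 := by
    rw [View.leader, hbid (by omega), h1 (by omega), ← localMax_localMax hG f v]
    congr 1
    refine maxHeard_eq G ident fun u hu => ?_
    rw [view_heard G ident (by omega) hu, ← h1 le_rfl]
    simp [View.message, hbid]
  obtain ⟨m, -, hm⟩ := Finset.exists_mem_eq_sup Finset.univ Finset.univ_nonempty
    fun v => (neighborIds G ident v).card
  obtain ⟨l, -, hl⟩ := Finset.exists_mem_eq_sup Finset.univ Finset.univ_nonempty f
  have hfm : f m ≤ f l := hl ▸ Finset.le_sup (Finset.mem_univ m)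
  have hm' : (neighborIds G ident m).card = maxDeg G ident := hm.symm
  have hlc : (neighborIds G ident l).card = maxDeg G ident := by
    -- Otherwise the winning bid would be `0`, but `m` has maximum degree and bids at least `1`.
    by_contra h
    simp [f, hm', h] at hfm
  refine ⟨l, hlc, fun t ht v => ?_⟩
  rw [h2 ht, hl]
  simp [f, hlc]

/-! ### Neighbour lists and the node set. -/

lemma view_nbrsOf {t : ℕ} (ht : 4 + maxDeg G ident ≤ t) {v y : V} (h : G.Adj v y) :
    (view G ident t v).nbrsOf (ident y) = neighborIds G ident y := by
  ext x
  rw [View.mem_nbrsOf, view_Δ ident hG (by omega),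
    mem_iff_exists_entry (card_neighborIds_le_maxDeg G ident y)]
  refine exists_congr fun i => and_congr_right fun hi => ?_
  rw [view_heard G ident (by omega) h]
  rw [View.message, view_time, view_Δ ident hG (by omega), if_neg (by omega), if_neg (by omega),
    if_neg (by omega), if_neg (by omega), if_pos (by omega), view_nbrs, Nat.add_sub_cancel_left]

/-- This tells every node the value of `n`, on which the halting time depends. -/
lemma view_nodes {t : ℕ} (ht : 4 + maxDeg G ident ≤ t) (v : V) :
    (view G ident t v).nodes = Finset.univ.map ident := by
  ext x
  simp only [View.nodes, view_id, view_nbrs, Finset.mem_insert, Finset.mem_union,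
    Finset.mem_biUnion, Finset.mem_map, Finset.mem_univ, true_and]
  constructor
  · rintro (rfl | hx | ⟨_, hy, hx⟩)
    · exact ⟨v, rfl⟩
    · obtain ⟨u, -, rfl⟩ := mem_neighborIds_iff.1 hx
      exact ⟨u, rfl⟩
    · obtain ⟨y, hvy, rfl⟩ := mem_neighborIds_iff.1 hy
      rw [view_nbrsOf ident hG ht hvy] at hx
      obtain ⟨u, -, rfl⟩ := mem_neighborIds_iff.1 hx
      exact ⟨u, rfl⟩
  · rintro ⟨u, rfl⟩
    rcases hG v u with rfl | h | ⟨w, hw, hu⟩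
    · exact .inl rfl
    · exact .inr (.inl (mem_neighborIds.2 h))
    · refine .inr (.inr ⟨ident w, mem_neighborIds.2 hw, ?_⟩)
      rw [view_nbrsOf ident hG ht hw]
      exact mem_neighborIds.2 hu

/-! ### Collecting the columns and rebuilding the graph. -/

variable {l : V} (hl : ∀ t, 4 ≤ t → ∀ v, (view G ident t v).leader = ident l)
include hl

lemma view_index {t : ℕ} (ht : 4 + maxDeg G ident ≤ t) {v : V} (h : G.Adj v l) :
    (view G ident t v).index = rank (neighborIds G ident l) (ident v) + 1 := by
  simp [View.index, hl t (by omega), mem_neighborIds.2 h, view_nbrsOf ident hG ht h]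

lemma view_heard_index {t : ℕ} (ht : 5 + maxDeg G ident ≤ t) {u v : V} (h : G.Adj v u)
    (hul : G.Adj u l) :
    (view G ident t v).heard (4 + maxDeg G ident) (ident u) =
      rank (neighborIds G ident l) (ident u) + 1 := by
  rw [view_heard G ident (by omega) h]
  rw [View.message, view_time, view_Δ ident hG (by omega), if_neg (by omega), if_neg (by omega),
    if_neg (by omega), if_neg (by omega), if_neg (by omega), if_pos rfl,
    view_index ident hG hl le_rfl hul]

/-- The middle node `y` knows the list of `w` and has been told the rank of `v`, so it can pick the
one entry that `v` collects. The rank of `w` is below the degree of `y`, hence below `Δ`, so the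
round lies in the relay window. -/
lemma view_heard_relay {t : ℕ} (ht : 5 + 2 * maxDeg G ident ≤ t) {v y w : V} (hvy : G.Adj v y)
    (hyw : G.Adj y w) (hvl : G.Adj v l) :
    (view G ident t v).heard
        (5 + maxDeg G ident + rank (neighborIds G ident y) (ident w)) (ident y) =
      entry (neighborIds G ident w) (rank (neighborIds G ident l) (ident v)) := by
  have hw := mem_neighborIds (ident := ident).2 hyw
  have hlt := rank_lt hw
  have hle := card_neighborIds_le_maxDeg G ident y
  set j := rank (neighborIds G ident y) (ident w) with hj
  have hΔ (v : V) := view_Δ ident hG (t := 5 + maxDeg G ident + j) (by omega) v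
  rw [view_heard G ident (by omega) hvy, View.message, view_time, hΔ,
    if_neg (by omega), if_neg (by omega), if_neg (by omega), if_neg (by omega), if_neg (by omega),
    if_neg (by omega), if_pos (by omega), Nat.add_sub_cancel_left, View.relay, hΔ, view_nbrs,
    view_heard_index ident hG hl (by omega) hvy.symm hvl, if_pos ⟨by omega, hlt⟩, hj, nth_rank hw,
    ← hj, view_nbrsOf ident hG (by omega) hyw, Nat.add_sub_cancel]

lemma view_report {t : ℕ} (ht : 5 + 2 * maxDeg G ident ≤ t) {v : V} (hvl : G.Adj v l) (w : V) :
    (view G ident t v).report (ident w) =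
      entry (neighborIds G ident w) (rank (neighborIds G ident l) (ident v)) := by
  rw [View.report, view_index ident hG hl (by omega) hvl, view_id, view_nbrs, Nat.add_sub_cancel]
  split_ifs with h1 h2
  · rw [ident.injective h1]
  · rw [view_nbrsOf ident hG (by omega) (mem_neighborIds.1 h2)]
  · have hcommon : ∃ y, G.Adj v y ∧ G.Adj y w := by
      rcases hG v w with rfl | h | h
      · exact absurd rfl h1
      · exact absurd (mem_neighborIds.2 h) h2
      · exact h
    obtain ⟨y, hvy, hyw⟩ := hcommon
    -- All common neighbours relay the same number, so the supremum is that of a constant over a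
    -- nonempty set.
    rw [Finset.sup_congr rfl (g := fun _ =>
      entry (neighborIds G ident w) (rank (neighborIds G ident l) (ident v)))]
    · refine Finset.sup_const ⟨ident y, ?_⟩ _
      rw [Finset.mem_filter, view_nbrsOf ident hG (by omega) hvy]
      exact ⟨mem_neighborIds.2 hvy, mem_neighborIds.2 hyw⟩
    · intro z hz
      obtain ⟨hz, hwz⟩ := Finset.mem_filter.1 hz
      obtain ⟨z, hvz, rfl⟩ := mem_neighborIds_iff.1 hz
      rw [view_nbrsOf ident hG (by omega) hvz] at hwz ⊢
      rw [view_Δ ident hG (by omega)]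
      exact view_heard_relay ident hG hl ht hvz (mem_neighborIds.1 hwz) hvl

/-- All nodes enumerate the same node set, so the round alone identifies `w` and no address need be
sent. -/
lemma view_heard_report {t : ℕ} (ht : 5 + 2 * maxDeg G ident + Fintype.card V ≤ t) {u : V}
    (h : G.Adj l u) (w : V) :
    (view G ident t l).heard
        (5 + 2 * maxDeg G ident + rank (Finset.univ.map ident) (ident w)) (ident u) =
      entry (neighborIds G ident w) (rank (neighborIds G ident l) (ident u)) := by
  have hw : ident w ∈ Finset.univ.map ident := by simp
  have hlt := rank_lt hw
  have hcard : (Finset.univ.map ident).card = Fintype.card V := by simp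
  set j := rank (Finset.univ.map ident) (ident w) with hj
  have hΔ (v : V) := view_Δ ident hG (t := 5 + 2 * maxDeg G ident + j) (by omega) v
  rw [view_heard G ident (by omega) h, View.message, view_time, hΔ,
    if_neg (by omega), if_neg (by omega), if_neg (by omega), if_neg (by omega), if_neg (by omega),
    if_neg (by omega), if_neg (by omega), view_nodes ident hG (by omega), if_pos (by omega),
    Nat.add_sub_cancel_left, hj, nth_rank hw, ← hj, view_report ident hG hl (by omega) h.symm]

/-- By `hdeg` the ranks of the leader's neighbours exhaust all `i < Δ`, so every entry of every list
has a collector. -/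
lemma view_isEdge (hdeg : (neighborIds G ident l).card = maxDeg G ident) {t : ℕ}
    (ht : 5 + 2 * maxDeg G ident + Fintype.card V ≤ t) (w x : V) :
    (view G ident t l).IsEdge (ident w) (ident x) ↔ G.Adj w x := by
  rw [View.IsEdge, view_nbrs, view_Δ ident hG (by omega), view_nodes ident hG (by omega),
    ← mem_neighborIds (ident := ident),
    mem_iff_exists_entry (card_neighborIds_le_maxDeg G ident w)]
  constructor
  · rintro ⟨_, hu, h⟩
    obtain ⟨u, hlu, rfl⟩ := mem_neighborIds_iff.1 hu
    rw [view_heard_report ident hG hl ht hlu] at h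
    exact ⟨_, (rank_lt hu).trans_eq hdeg, h⟩
  · rintro ⟨i, hi, h⟩
    have hi' : i < (neighborIds G ident l).card := hi.trans_eq hdeg.symm
    obtain ⟨u, hlu, hu⟩ := mem_neighborIds_iff.1 (nth_mem hi')
    refine ⟨ident u, mem_neighborIds.2 hlu, ?_⟩
    rw [view_heard_report ident hG hl ht hlu, hu, rank_nth hi', h]

lemma nonempty_iso_graph (hdeg : (neighborIds G ident l).card = maxDeg G ident) {t : ℕ}
    (ht : 5 + 2 * maxDeg G ident + Fintype.card V ≤ t) :
    Nonempty (G ≃g (view G ident t l).graph.{u}) := by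
  have hmem (v : V) : ident v ∈ (view G ident t l).nodes := by
    simp [view_nodes ident hG (t := t) (by omega)]
  let f : V → ULift.{u} {x // x ∈ (view G ident t l).nodes} := fun v => ⟨ident v, hmem v⟩
  have hf : Function.Bijective f := by
    constructor
    · intro v w h
      exact ident.injective (congrArg (fun x => x.down.1) h)
    · rintro ⟨x, hx⟩
      have hx' := hx
      rw [view_nodes ident hG (t := t) (by omega)] at hx'
      obtain ⟨v, -, rfl⟩ := Finset.mem_map.1 hx'
      exact ⟨v, rfl⟩
  refine ⟨⟨Equiv.ofBijective f hf, fun {v w} => ?_⟩⟩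
  simp only [View.graph, SimpleGraph.fromRel_adj, Equiv.ofBijective_apply, ne_eq, hf.1.eq_iff, f,
    view_isEdge ident hG hl hdeg ht]
  constructor
  · rintro ⟨-, h | h⟩
    exacts [h, h.symm]
  · exact fun h => ⟨h.ne, .inl h⟩

/-! ### Halting time. -/

omit hl in
lemma view_isFinal {t : ℕ} (v : V) :
    (view G ident t v).IsFinal ↔ t = 5 + 2 * maxDeg G ident + Fintype.card V := by
  have hcard : (Finset.univ.map ident).card = Fintype.card V := by simp
  rw [View.IsFinal, view_time]
  constructor
  -- `h2` and `h4` ensure that the locally computed `Δ` and `nodes` already have their true values,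
  -- so no node stops early.
  · rintro ⟨h2, h4, h⟩
    rw [view_Δ ident hG h2] at h4 h
    rwa [view_nodes ident hG h4, hcard] at h
  · intro h
    rw [view_Δ ident hG (by omega), view_nodes ident hG (by omega), hcard]
    omega

-- No view is final before the last round, so the halting tests in `run` stay inactive up to then.
omit hl in
lemma run_eq_view (P : ∀ V : Type u, SimpleGraph V → Prop) (ω : V → ℕ → Bool) {t : ℕ}
    (ht : t ≤ 5 + 2 * maxDeg G ident + Fintype.card V) :
    (algorithm P).run G ident ω t = view G ident t := by
  classical
  induction t with
  | zero => rfl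
  | succ t ih =>
    have hout (v : V) : (algorithm P).output (view G ident t v) = none := by
      simp only [algorithm, view_isFinal ident hG]
      rw [if_neg (by omega)]
    funext v
    refine (if_pos (by rw [ih (by omega)]; exact hout v)).trans ?_
    rw [ih (by omega)]
    exact congrArg (fun f => (view G ident t v).receive (Function.extend ident f fun _ => []))
      (funext fun u => by simp only [hout u, and_true]; rfl)

end Correctness

/-! ### From gathering to deciding. -/

/-- A property that is invariant under isomorphisms can be decided on graphs of diameter 2. -/
theorem decidableOnDiameterTwo (P : ∀ V : Type u, SimpleGraph V → Prop)
    (hP : ∀ (V V' : Type u) (G : SimpleGraph V) (G' : SimpleGraph V'),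
      Nonempty (G ≃g G') → (P V G ↔ P V' G')) : DecidableOnDiameterTwo P := by
  classical
  intro a c
  refine ⟨algorithm P, 2 * ((a + 1 : ℕ) + 1) / Real.log 2, 6 / Real.log 2 ^ 2, ?_⟩
  intro V _ G ident hdiam hident
  have : Nontrivial V := SimpleGraph.nontrivial_of_ediam_ne_zero (G := G) (by simp [hdiam])
  have hn : 2 ≤ Fintype.card V := Fintype.one_lt_card
  have hG := isWithinTwo_of_ediam hdiam
  refine ⟨hasBandwidth P hn hident, 5 + 2 * maxDeg G ident + Fintype.card V, ?_, ?_⟩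
  · have h2 : 0 < Real.log 2 := Real.log_pos one_lt_two
    have hlog : Real.log 2 ≤ Real.log (Fintype.card V) :=
      Real.log_le_log two_pos (by exact_mod_cast hn)
    have hT : 5 + 2 * maxDeg G ident + Fintype.card V ≤ 6 * Fintype.card V := by
      have := maxDeg_le G ident
      omega
    calc ((5 + 2 * maxDeg G ident + Fintype.card V : ℕ) : ℝ)
        ≤ 6 * Fintype.card V := by exact_mod_cast hT
      -- As `n ≥ 2`, the factor `log 2 ^ 2` may be raised to `log n ^ 2`.
      _ = 6 / Real.log 2 ^ 2 * (Fintype.card V * Real.log 2 ^ 2) := by field_simp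
      _ ≤ _ := by gcongr
  · obtain ⟨l, hdeg, hl⟩ := exists_leader ident hG
    have hrun (ω : V → ℕ → Bool) : (algorithm P).DecidesBy G ident (P V G)
        (5 + 2 * maxDeg G ident + Fintype.card V) ω := by
      have hout (v : V) : (algorithm P).output ((algorithm P).run G ident ω
          (5 + 2 * maxDeg G ident + Fintype.card V) v) = some (decide (l = v → P V G)) := by
        rw [run_eq_view ident hG P ω le_rfl]
        simp only [algorithm]
        rw [if_pos ((view_isFinal ident hG v).2 rfl), Option.some_inj, decide_eq_decide,
          hl _ (by omega), view_id, ident.injective.eq_iff]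
        -- Away from the leader the implication is vacuous and the output is yes; only the leader
        -- tests `P`, on its isomorphic copy of `G`.
        refine forall_congr' fun h => ?_
        subst h
        exact (hP _ _ _ _ (nonempty_iso_graph ident hG hl hdeg le_rfl)).symm
      refine ⟨fun v => by simp [hout], fun h v => by simp [hout, h], fun h => ⟨l, ?_⟩⟩
      simp [hout, h]
    have huniv : {ω | (algorithm P).DecidesBy G ident (P V G)
        (5 + 2 * maxDeg G ident + Fintype.card V) ω} = Set.univ := Set.eq_univ_of_forall hrun
    have hprob : IsProbabilityMeasure (tapeMeasure V) := by
      unfold tapeMeasure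
      infer_instance
    rw [huniv]
    refine ⟨MeasurableSet.univ, ?_⟩
    rw [probReal_univ, sub_le_self_iff]
    positivity

end Congest.Gather

theorem mainTheorem10 {W : Type*} [Finite W] (H : SimpleGraph W) :
    Congest.DecidableOnDiameterTwo.{u} (fun _ G => ¬ H.IsContained G) ∧
    Congest.DecidableOnDiameterTwo.{u} (fun _ G => ¬ H.IsIndContained G) :=
  ⟨Congest.Gather.decidableOnDiameterTwo _ fun _ _ _ _ ⟨e⟩ =>
      not_congr (SimpleGraph.isContained_congr_right e),
    Congest.Gather.decidableOnDiameterTwo _ fun _ _ _ _ ⟨e⟩ =>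
      not_congr ⟨fun h => h.trans e.isIndContained, fun h => h.trans e.isIndContained'⟩⟩
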